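/- **Setting.** First-order rational Pavelka logic $\mathrm{RPL}\forall$ is used with $0$ as the highest and $1$ as the lowest degree of truth: $\varphi\to\psi$ has value $\max\{\psi-\varphi,0\}$, $\forall$ is the supremum, and there is a truth constant $\bar r$ for each rational $r\in[0,1]$ (with $\bot=\bar 1$). Provability $\vdash$ is by the usual axioms of Łukasiewicz logic, the two quantifier axioms, the bookkeeping axioms $(\bar r\to\bar s)\leftrightarrow\overline{\max\{s-r,0\}}$, and reflexivity, symmetry and transitivity of the similarity relation $\approx$, with modus ponens and generalization. Let $L$ be a computably given countable metric signature: its sets of function and relation symbols are decidable, its arities are computable, and every symbol $s$ and argument place $i$ carries a modulus $\delta_{s,i}:(0,1]\to(0,1]$. A structure consists of a set with functions, $[0,1]$-valued relations, and a $[0,1]$-valued pseudo-metric interpreting $\approx$. Let $UL$ be the set of uniform continuity axioms $(q\mathbin{\dot-}(x\approx y))\vee((R(\bar a,x,\bar b)\mathbin{\dot-}R(\bar a,y,\bar b))\mathbin{\dot-}r)$ and $(q\mathbin{\dot-}(x\approx y))\vee((f(\bar a,x,\bar b)\approx f(\bar a,y,\bar b))\mathbin{\dot-}r)$, for rationals $\epsilon,q,r\in[0,1]$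 with $\epsilon>0$, $r>\epsilon$, $q<\delta_{s,i}(\epsilon)$, where $s$ is the symbol and $x$ stands at place $i$; here $u\mathbin{\dot-}v$ has value $\max\{u-v,0\}$ and $\vee$ is the minimum. For a structure $M$ and a map $\nu:A\to M$ naming parameters, $\mathrm{Diag}_{el}(M,\nu)$ is the set of pairs $(\varphi,b)$ of a formula $\varphi$ of $L$ with constants from $A$ and an interval $b$ with rational end points in $[0,1]$ such that $b\ll\{\|\varphi\|_M\}$ in the domain of closed subintervals of $[0,1]$ under reverse inclusion ($\ll$ is the way-below relation, $\|\varphi\|_M$ is the supremum of the truth degrees over all evaluations). A structure $M$ is decidable over $\nu:\mathbb N\to M$ if $\nu$ has dense range and $\mathrm{Diag}_{el}(M,\nu)$ is computably enumerable; it is decidable if this holds for some $\nu$. **Theorem 3.12.** Let $T$ be a theory in $L$, and suppose that $T^*=T\cup UL$ is consistent, linear-complete (for all sentences $\varphi,\psi$, $T^*\vdash\varphi\to\psi$ or $T^*\vdash\psi\to\varphi$), computably axiomatizable and Henkin (if $T^*\vdash\exists x\,\varphi$ for a sentence $\exists x\,\varphi$, then $T^*\vdash\varphi[c/x]$ for some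 constant symbol $c$ of $L$). Let $B$ be a countable model of $T^*$ that is decidable over an enumeration $\nu:\mathbb N\to B$ of all its elements (for instance, the model whose elements are the constants of $L$ and whose truth degrees are the provability degrees). Let $M$ be the metric completion of the quotient of $B$ by the relation of being at distance $0$, and let $\iota:B\to M$ be the canonical map. Then $M$ carries an $L$-structure that interprets $\approx$ by the metric of $M$ (so it is a complete metric structure) such that: 1. $M\models T^*$; 2. $\iota$ commutes with the functions, and every formula with parameters from $B$ has the same truth degree in $B$ (under any evaluation) and in $M$ (under the evaluation composed with $\iota$, the parameters being read through $\iota$); that is, the image of $B$ is an elementary substructure of $M$; 3. $B$ and $M$ are elementarily equivalent: every sentence of $L$ has the same truth degree in both; 4. $\mathrm{Diag}_{el}(M,\iota)=\mathrm{Diag}_{el}(B,\mathrm{id}_B)$; 5. $M$ is decidable, namely over the dense sequence $\iota\circ\nu$. -/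

import Mathlib

/-! First-order rational Pavelka logic over a metric signature. As usual in continuous logic, `0` is
the highest degree of truth and `1` the least one. -/

namespace RPL

universe u v

/-- A (countable) metric continuous signature: function and relation symbols (coded by natural
numbers) with arities, and for every symbol and every argument place a modulus of continuity
`δ : (0,1] → (0,1]`. The distinguished binary relation `≈` is a separate atomic formula below.
Constants are the function symbols of arity `0`. -/
structure Signature where
  Fn : Set ℕ
  Rel : Set ℕ
  fnArity : Fn → ℕ
  relArity : Rel → ℕ
  fnMod : (f : Fn) → Fin (fnArity f) → Set.Ioc (0 : ℝ) 1 → Set.Ioc (0 : ℝ) 1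
  relMod : (R : Rel) → Fin (relArity R) → Set.Ioc (0 : ℝ) 1 → Set.Ioc (0 : ℝ) 1

/-- The sets of symbols are decidable and the arities are computable. -/
structure Signature.ComputablyGiven (L : Signature) : Prop where
  fn_decidable : ComputablePred (fun n => n ∈ L.Fn)
  rel_decidable : ComputablePred (fun n => n ∈ L.Rel)
  fnArity_computable : ∃ g : ℕ → ℕ, Computable g ∧ ∀ f : L.Fn, g f = L.fnArity f
  relArity_computable : ∃ g : ℕ → ℕ, Computable g ∧ ∀ R : L.Rel, g R = L.relArity R

/-- Rationals in `[0,1]`. -/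
abbrev RatUnit : Type := Set.Icc (0 : ℚ) 1

/-- Truncated subtraction `s ∸ r` on the rationals of `[0,1]`. -/
def RatUnit.tsub (s r : RatUnit) : RatUnit :=
  ⟨max (s.1 - r.1) 0, le_max_right _ _, max_le (by linarith [s.2.2, r.2.1]) zero_le_one⟩

/-- Truncated subtraction `y ∸ x` on `[0,1]`. -/
noncomputable def tsub (y x : unitInterval) : unitInterval :=
  ⟨max ((y : ℝ) - x) 0, le_max_right _ _, max_le (by linarith [y.2.2, x.2.1]) zero_le_one⟩

/-- The real truth value of a rational truth constant. -/
noncomputable def RatUnit.toUnit (q : RatUnit) : unitInterval :=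
  ⟨(q.1 : ℝ), by exact_mod_cast q.2.1, by exact_mod_cast q.2.2⟩

/-! ### Syntax -/

/-- Terms of `L_A`: the language `L` with a new constant for every element of `A`. -/
inductive Term (L : Signature) (A : Type u) : Type u
  | var (n : ℕ) : Term L A
  | param (a : A) : Term L A
  | app (f : L.Fn) (ts : Fin (L.fnArity f) → Term L A) : Term L A

/-- Formulas of `L_A`, with primitive connectives `→`, `∀` and the truth constants. -/
inductive Formula (L : Signature) (A : Type u) : Type u
  | rel (R : L.Rel) (ts : Fin (L.relArity R) → Term L A) : Formula L A
  | sim (t s : Term L A) : Formula L A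
  | const (r : RatUnit) : Formula L A
  | imp (φ ψ : Formula L A) : Formula L A
  | all (x : ℕ) (φ : Formula L A) : Formula L A

/-- Formulas of `L` itself. -/
abbrev LFormula (L : Signature) : Type := Formula L Empty

section Calculus

variable {L : Signature} {A : Type u}

/-- The constant symbol `c`, as a term. -/
def Term.ofConstant (c : L.Fn) (hc : L.fnArity c = 0) : Term L A :=
  .app c (fun i => (Fin.cast hc i).elim0)

/-- The variable `x` occurs in the term. -/
def Term.Occurs (x : ℕ) : Term L A → Prop
  | .var y => x = y
  | .param _ => False
  | .app _ ts => ∃ i, (ts i).Occurs x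

/-- `s[t/x]`, written `s.subst x t`. -/
def Term.subst : Term L A → ℕ → Term L A → Term L A
  | .var y, x, t => if y = x then t else .var y
  | .param a, _, _ => .param a
  | .app f ts, x, t => .app f (fun i => (ts i).subst x t)

namespace Formula

/-- Falsity, the truth constant of value `1`. -/
def bot : Formula L A := .const ⟨1, zero_le_one, le_rfl⟩

def neg (φ : Formula L A) : Formula L A := φ.imp bot

/-- Strong conjunction `φ ⊕ ψ`, of value `min (φ + ψ) 1`. -/
def oplus (φ ψ : Formula L A) : Formula L A := (φ.imp ψ.neg).neg

/-- Weak disjunction `φ ∨ ψ`, of value `min φ ψ`. -/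
def or (φ ψ : Formula L A) : Formula L A := (φ.imp ψ).imp ψ

def iff (φ ψ : Formula L A) : Formula L A := (φ.imp ψ).oplus (ψ.imp φ)

def ex (x : ℕ) (φ : Formula L A) : Formula L A := (Formula.all x φ.neg).neg

/-- `φ ∸ ψ`, that is `ψ → φ`. -/
def minus (φ ψ : Formula L A) : Formula L A := ψ.imp φ

/-- The variable `x` is free in the formula. -/
def Free (x : ℕ) : Formula L A → Prop
  | .rel _ ts => ∃ i, (ts i).Occurs x
  | .sim t s => t.Occurs x ∨ s.Occurs x
  | .const _ => False
  | .imp φ ψ => φ.Free x ∨ ψ.Free x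
  | .all y φ => x ≠ y ∧ φ.Free x

def IsSentence (φ : Formula L A) : Prop := ∀ x, ¬ φ.Free x

/-- `φ[t/x]`, written `φ.subst x t`: the free occurrences of `x` are replaced by `t`. -/
def subst : Formula L A → ℕ → Term L A → Formula L A
  | .rel R ts, x, t => .rel R (fun i => (ts i).subst x t)
  | .sim s₁ s₂, x, t => .sim (s₁.subst x t) (s₂.subst x t)
  | .const r, _, _ => .const r
  | .imp φ ψ, x, t => .imp (φ.subst x t) (ψ.subst x t)
  | .all y φ, x, t => if y = x then .all y φ else .all y (φ.subst x t)

/-- No variable of `t` becomes bound when `t` is substituted for `x` in the formula. -/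
def Substitutable (x : ℕ) (t : Term L A) : Formula L A → Prop
  | .rel _ _ => True
  | .sim _ _ => True
  | .const _ => True
  | .imp φ ψ => φ.Substitutable x t ∧ ψ.Substitutable x t
  | .all y φ => ¬ (Formula.all y φ).Free x ∨ (¬ t.Occurs y ∧ φ.Substitutable x t)

end Formula

/-! ### The deduction system -/

/-- The logical axioms: Łukasiewicz logic, quantifiers, bookkeeping for the truth constants, and
similarity (reflexivity, symmetry, transitivity). Congruence is not included. -/
inductive LogicalAx : Formula L A → Prop
  | l1 (φ ψ : Formula L A) : LogicalAx (φ.imp (ψ.imp φ))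
  | l2 (φ ψ σ : Formula L A) : LogicalAx ((φ.imp ψ).imp ((ψ.imp σ).imp (φ.imp σ)))
  | l3 (φ ψ : Formula L A) : LogicalAx (((φ.imp ψ).imp ψ).imp ((ψ.imp φ).imp φ))
  | l4 (φ ψ : Formula L A) :
      LogicalAx (((φ.imp Formula.bot).imp (ψ.imp Formula.bot)).imp (ψ.imp φ))
  | all1 (x : ℕ) (t : Term L A) (φ : Formula L A) (h : φ.Substitutable x t) :
      LogicalAx ((Formula.all x φ).imp (φ.subst x t))
  | all2 (x : ℕ) (φ ψ : Formula L A) (h : ¬ φ.Free x) :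
      LogicalAx ((Formula.all x (φ.imp ψ)).imp (φ.imp (Formula.all x ψ)))
  | book (r s : RatUnit) :
      LogicalAx (((Formula.const r).imp (Formula.const s)).iff (Formula.const (s.tsub r)))
  | simRefl (x : ℕ) : LogicalAx (.sim (.var x) (.var x))
  | simSymm (x y : ℕ) :
      LogicalAx (Formula.imp (.sim (.var x) (.var y)) (.sim (.var y) (.var x)))
  | simTrans (x y z : ℕ) :
      LogicalAx (Formula.imp
        (Formula.oplus (.sim (.var x) (.var y)) (.sim (.var y) (.var z)))
        (.sim (.var x) (.var z)))

/-- `T ⊢ φ`, by modus ponens and generalization. -/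
inductive Provable (T : Set (Formula L A)) : Formula L A → Prop
  | logical {φ : Formula L A} (h : LogicalAx φ) : Provable T φ
  | hyp {φ : Formula L A} (h : φ ∈ T) : Provable T φ
  | mp {φ ψ : Formula L A} (h₁ : Provable T φ) (h₂ : Provable T (φ.imp ψ)) : Provable T ψ
  | gen (x : ℕ) {φ : Formula L A} (h : Provable T φ) : Provable T (Formula.all x φ)

def Consistent (T : Set (Formula L A)) : Prop := ¬ Provable T Formula.bot

def LinearComplete (T : Set (Formula L A)) : Prop :=
  ∀ φ ψ : Formula L A, φ.IsSentence → ψ.IsSentence →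
    Provable T (φ.imp ψ) ∨ Provable T (ψ.imp φ)

/-- If `T` proves a sentence `∃ x φ`, then it proves `φ[c/x]` for some constant symbol `c`. -/
def Henkin (T : Set (Formula L A)) : Prop :=
  ∀ (x : ℕ) (φ : Formula L A), (Formula.ex x φ).IsSentence → Provable T (Formula.ex x φ) →
    ∃ (c : L.Fn) (hc : L.fnArity c = 0), Provable T (φ.subst x (Term.ofConstant c hc))

end Calculus

/-! ### Uniform continuity axioms -/

/-- The uniform continuity axioms `UL` of the signature: for all rational `ε, q, r ∈ [0,1]` with
`ε > 0`, `r > ε` and `q < δ ε`, where `δ` is the modulus of the symbol at its `i`-th place,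
`(q ∸ (x ≈ y)) ∨ ((R(a,x,b) ∸ R(a,y,b)) ∸ r)`, and
`(q ∸ (x ≈ y)) ∨ ((f(a,x,b) ≈ f(a,y,b)) ∸ r)`. The arguments are the variables `0, …, n - 1`, where
`n` is the arity; `x` is the variable `i`, and `y` is the variable `n`. -/
inductive UL (L : Signature) : LFormula L → Prop
  | rel (R : L.Rel) (i : Fin (L.relArity R)) (ε q r : RatUnit)
      (hε : (ε.1 : ℝ) ∈ Set.Ioc (0 : ℝ) 1) (hr : ε < r)
      (hq : (q.1 : ℝ) < (L.relMod R i ⟨(ε.1 : ℝ), hε⟩ : ℝ)) :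
      UL L (Formula.or
        ((Formula.const q).minus (.sim (.var i) (.var (L.relArity R))))
        (Formula.minus
          ((Formula.rel R (fun j => .var j)).minus
            (Formula.rel R (Function.update (fun j => .var j) i (.var (L.relArity R)))))
          (.const r)))
  | fn (f : L.Fn) (i : Fin (L.fnArity f)) (ε q r : RatUnit)
      (hε : (ε.1 : ℝ) ∈ Set.Ioc (0 : ℝ) 1) (hr : ε < r)
      (hq : (q.1 : ℝ) < (L.fnMod f i ⟨(ε.1 : ℝ), hε⟩ : ℝ)) :
      UL L (Formula.or
        ((Formula.const q).minus (.sim (.var i) (.var (L.fnArity f))))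
        (Formula.minus
          (.sim (.app f (fun j => .var j))
            (.app f (Function.update (fun j => .var j) i (.var (L.fnArity f)))))
          (.const r)))

/-- The theory in rational Pavelka logic that corresponds to the theory `T` of continuous logic:
`T` together with the uniform continuity axioms of the signature. -/
def withUL {L : Signature} (T : Set (LFormula L)) : Set (LFormula L) := T ∪ {φ | UL L φ}

/-! ### Semantics -/

/-- A standard structure: functions, `[0,1]`-valued relations, and a `[0,1]`-valued pseudo-metric
that interprets `≈`. (The moduli of continuity are imposed by the axioms `UL`.) -/
structure PreStructure (L : Signature) (M : Type u) where
  fn : (f : L.Fn) → (Fin (L.fnArity f) → M) → M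
  rel : (R : L.Rel) → (Fin (L.relArity R) → M) → unitInterval
  sim : M → M → unitInterval
  sim_self : ∀ x, sim x x = 0
  sim_comm : ∀ x y, sim x y = sim y x
  sim_triangle : ∀ x y z, (sim x z : ℝ) ≤ sim x y + sim y z

namespace PreStructure

variable {L : Signature} {M : Type u} {A : Type v}

/-- The pseudo-metric that interprets `≈`. -/
@[reducible] def pseudoMetricSpace (S : PreStructure L M) : PseudoMetricSpace M where
  dist x y := (S.sim x y : ℝ)
  dist_self x := by rw [S.sim_self]; rfl
  dist_comm x y := by rw [S.sim_comm]
  dist_triangle := S.sim_triangle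

/-- The value of a term, where the parameters are named by `ρ` and the variables evaluated by `e`. -/
def termVal (S : PreStructure L M) (ρ : A → M) (e : ℕ → M) : Term L A → M
  | .var n => e n
  | .param a => ρ a
  | .app f ts => S.fn f (fun i => S.termVal ρ e (ts i))

/-- The truth degree of a formula in `(M, e)`. -/
noncomputable def val (S : PreStructure L M) (ρ : A → M) : (ℕ → M) → Formula L A → unitInterval
  | e, .rel R ts => S.rel R (fun i => S.termVal ρ e (ts i))
  | e, .sim t s => S.sim (S.termVal ρ e t) (S.termVal ρ e s)
  | _, .const r => r.toUnit
  | e, .imp φ ψ => tsub (S.val ρ e ψ) (S.val ρ e φ)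
  | e, .all x φ => ⨆ a : M, S.val ρ (Function.update e x a) φ

/-- The truth degree `‖φ‖_M`: the supremum over all evaluations. -/
noncomputable def degree (S : PreStructure L M) (ρ : A → M) (φ : Formula L A) : unitInterval :=
  ⨆ e : ℕ → M, S.val ρ e φ

/-- `M ⊨ T`: every formula of `T` has truth degree `0` under every evaluation. -/
def Models (S : PreStructure L M) (T : Set (LFormula L)) : Prop :=
  ∀ φ ∈ T, ∀ e : ℕ → M, S.val Empty.elim e φ = 0

/-- The pseudo-metric is a metric. -/
def IsMetric (S : PreStructure L M) : Prop := ∀ x y, S.sim x y = 0 → x = y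

/-- The pseudo-metric is complete. -/
def IsComplete (S : PreStructure L M) : Prop :=
  @CompleteSpace M S.pseudoMetricSpace.toUniformSpace

variable {N : Type v}

/-- All sentences of the language have the same truth degree in the two structures. -/
def ElementarilyEquivalent (S : PreStructure L M) (S' : PreStructure L N) : Prop :=
  ∀ φ : LFormula L, φ.IsSentence → S.degree Empty.elim φ = S'.degree Empty.elim φ

/-- `j` commutes with the functions, and every formula of `L_M` keeps its truth degree: the image
of `j` is an elementary substructure. -/
def IsElementaryMap (S : PreStructure L M) (S' : PreStructure L N) (j : M → N) : Prop :=
  (∀ (f : L.Fn) (a : Fin (L.fnArity f) → M), j (S.fn f a) = S'.fn f (j ∘ a)) ∧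
    ∀ (φ : Formula L M) (e : ℕ → M), S'.val j (j ∘ e) φ = S.val id e φ

end PreStructure

/-! ### The interval domain and decidable structures -/

/-- `x` is way below `y`: if `y` is below the supremum of a directed set, then `x` is below one of
its members. -/
def WayBelow {P : Type*} [Preorder P] (x y : P) : Prop :=
  ∀ D : Set P, D.Nonempty → DirectedOn (· ≤ ·) D → ∀ s, IsLUB D s → y ≤ s → ∃ d ∈ D, x ≤ d

/-- The unit interval domain: the nonempty closed subintervals of `[0,1]` under reverse inclusion. -/
abbrev IntervalDomain : Type := (NonemptyInterval unitInterval)ᵒᵈ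

/-- The effective base of the unit interval domain: intervals with rational end points. -/
abbrev RatInterval : Type := NonemptyInterval RatUnit

noncomputable def RatInterval.toDomain (b : RatInterval) : IntervalDomain :=
  OrderDual.toDual ⟨(b.fst.toUnit, b.snd.toUnit), by
    have h : (b.fst : ℚ) ≤ b.snd := b.fst_le_snd
    exact Subtype.mk_le_mk.mpr (by exact_mod_cast h)⟩

/-- The embedding `x ↦ {x}` of `[0,1]` into its interval domain. -/
def pointInDomain (x : unitInterval) : IntervalDomain := OrderDual.toDual (NonemptyInterval.pure x)

/-! Gödel numbers. -/

def RatUnit.code (q : RatUnit) : ℕ := Nat.pair q.1.num.natAbs q.1.den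

def RatInterval.code (b : RatInterval) : ℕ := Nat.pair b.fst.code b.snd.code

section Coding

variable {L : Signature} {A : Type u}

/-- The Gödel number of a term, where the parameter `a` is coded by `c a`. -/
def Term.code (c : A → ℕ) : Term L A → ℕ
  | .var n => Nat.pair 0 n
  | .param a => Nat.pair 1 (c a)
  | .app f ts => Nat.pair 2 (Nat.pair f (Encodable.encode (List.ofFn fun i => (ts i).code c)))

/-- The Gödel number of a formula, where the parameter `a` is coded by `c a`. -/
def Formula.code (c : A → ℕ) : Formula L A → ℕ
  | .rel R ts => Nat.pair 0 (Nat.pair R (Encodable.encode (List.ofFn fun i => (ts i).code c)))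
  | .sim t s => Nat.pair 1 (Nat.pair (t.code c) (s.code c))
  | .const r => Nat.pair 2 r.code
  | .imp φ ψ => Nat.pair 3 (Nat.pair (φ.code c) (ψ.code c))
  | .all x φ => Nat.pair 4 (Nat.pair x (φ.code c))

end Coding

/-- The set of (Gödel numbers of) axioms of `T` is computably enumerable. -/
def ComputablyAxiomatizable {L : Signature} (T : Set (LFormula L)) : Prop :=
  REPred (fun n : ℕ => ∃ φ ∈ T, φ.code Empty.elim = n)

namespace PreStructure

variable {L : Signature} {M : Type u} {A : Type v}

/-- The elementary diagram with parameters from `A`, named in `M` by `ρ`: all pairs `(φ, b)` of a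
formula `φ` of `L_A` and a rational interval `b` that approximates the truth degree of `φ`. -/
def elemDiagram (S : PreStructure L M) (ρ : A → M) : Set (Formula L A × RatInterval) :=
  {p | WayBelow p.2.toDomain (pointInDomain (S.degree ρ p.1))}

/-- `S` is decidable over the countable set `X` enumerated by `ν`: `X` is dense, and the elementary
diagram of `S` with parameters from `X` (where `ν n` is named by `n`) is computably enumerable. -/
def DecidableOver (S : PreStructure L M) (ν : ℕ → M) : Prop :=
  @DenseRange M S.pseudoMetricSpace.toUniformSpace.toTopologicalSpace ℕ ν ∧
    REPred (fun n : ℕ => ∃ p ∈ S.elemDiagram ν, Nat.pair (p.1.code id) p.2.code = n)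

/-- A decidable structure. -/
def IsDecidable (S : PreStructure L M) : Prop := ∃ ν : ℕ → M, S.DecidableOver ν

/-- The underlying set of the metric completion of `S`: the completion of the metric quotient in
which points at distance `0` are identified. -/
def Completion (S : PreStructure L M) : Type u :=
  letI := S.pseudoMetricSpace
  UniformSpace.Completion (SeparationQuotient M)

noncomputable instance (S : PreStructure L M) : MetricSpace S.Completion :=
  letI := S.pseudoMetricSpace
  (inferInstance : MetricSpace (UniformSpace.Completion (SeparationQuotient M)))

/-- The canonical map of `S` into its metric completion. -/
def toCompletion (S : PreStructure L M) (x : M) : S.Completion :=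
  letI := S.pseudoMetricSpace
  ((SeparationQuotient.mk x : SeparationQuotient M) :
    UniformSpace.Completion (SeparationQuotient M))

end PreStructure

end RPL

/-! The axioms `UL` make every function and relation of B uniformly continuous in each argument,
uniformly in the others. Arities are finite, so changing the arguments one at a time gives joint
uniform continuity, and the symbols extend to the metric completion (`exists_completion_structure`).

By induction on formulas, truth degrees there depend uniformly continuously on the evaluation, for
the uniform distance over all variables (`exists_dist_val_le`). Hence a supremum over the completion
is already reached by the dense image of B. This is the quantifier case of `val_comp`; the same
argument for all variables at once gives `degree_comp`.

The rest is read off from degrees: a formula holds under all evaluations exactly when its degree is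
`0`, and the elementary diagram depends on degrees alone, so one enumeration serves both structures.
-/

namespace RPL

universe u v w

open Filter Topology

/-! ### Uniform continuity and extension in several arguments -/

section UniformExtension

/-- A function of finitely many arguments that is uniformly continuous in every argument, uniformly
in the others, is uniformly continuous. -/
theorem uniformContinuous_of_forall_update {ι : Type*} [Fintype ι] [DecidableEq ι] {X Z : Type*}
    [PseudoMetricSpace X] [PseudoMetricSpace Z] (g : (ι → X) → Z)
    (h : ∀ i, ∀ ε > 0, ∃ δ > 0, ∀ (a : ι → X) (y : X), dist (a i) y < δ →
      dist (g a) (g (Function.update a i y)) ≤ ε) : UniformContinuous g := by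
  -- Induction on the set `s` of coordinates at which `a` has been replaced by `b`.
  have key : ∀ (s : Finset ι), ∀ ε > 0, ∃ δ > 0, ∀ a b : ι → X, (∀ i, dist (a i) (b i) < δ) →
      dist (g a) (g (s.piecewise b a)) ≤ ε := by
    intro s
    induction s using Finset.induction_on with
    | empty =>
      intro ε hε
      exact ⟨1, one_pos, fun a b _ => by simpa using hε.le⟩
    | insert j s hj ih =>
      intro ε hε
      obtain ⟨δ₁, hδ₁, h₁⟩ := ih (ε / 2) (half_pos hε)
      obtain ⟨δ₂, hδ₂, h₂⟩ := h j (ε / 2) (half_pos hε)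
      refine ⟨min δ₁ δ₂, lt_min hδ₁ hδ₂, fun a b hab => ?_⟩
      rw [Finset.piecewise_insert]
      have e₁ := h₁ a b fun i => (hab i).trans_le (min_le_left _ _)
      have e₂ := h₂ (s.piecewise b a) (b j) (by
        rw [Finset.piecewise_eq_of_notMem _ _ _ hj]
        exact (hab j).trans_le (min_le_right _ _))
      linarith [dist_triangle (g a) (g (s.piecewise b a))
        (g (Function.update (s.piecewise b a) j (b j)))]
  rw [Metric.uniformContinuous_iff]
  intro ε hε
  obtain ⟨δ, hδ, hg⟩ := key Finset.univ (ε / 2) (half_pos hε)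
  refine ⟨δ, hδ, fun {a b} hab => ?_⟩
  have := hg a b fun i => (dist_le_pi_dist a b i).trans_lt hab
  rw [Finset.piecewise_univ] at this
  linarith

/-- Every small enough positive number works. Using the filter instead of a minimum covers the empty
index set, that is, symbols of arity 0. -/
theorem exists_pos_forall_lt_of_finite {ι : Type*} [Finite ι] {η : ι → ℝ} (hη : ∀ i, 0 < η i) :
    ∃ θ > 0, ∀ i, θ < η i := by
  have h : ∀ᶠ θ in 𝓝[>] (0 : ℝ), ∀ i, θ < η i :=
    eventually_all.2 fun i => nhdsWithin_le_nhds (eventually_lt_nhds (hη i))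
  obtain ⟨θ, h, h₀⟩ := (h.and self_mem_nhdsWithin).exists
  exact ⟨θ, h₀, h⟩

/-- Both product uniformities are infima of pullbacks along the coordinates, and pullback commutes
with infima. -/
theorem isUniformInducing_piMap {ι X C : Type*} [UniformSpace X] [UniformSpace C] {j : X → C}
    (hj : IsUniformInducing j) : IsUniformInducing (Pi.map (fun _ : ι => j)) := by
  rw [isUniformInducing_iff, Pi.uniformity, Pi.uniformity, comap_iInf]
  refine iInf_congr fun i => ?_
  rw [← hj.comap_uniformity, comap_comap, comap_comap]
  rfl

/-- Uniformly continuous functions of several arguments extend along a dense uniform embedding of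
the space of arguments. -/
theorem exists_uniformContinuous_extension {ι X C Z : Type*} [UniformSpace X] [UniformSpace C]
    [UniformSpace Z] [CompleteSpace Z] [T2Space Z] {j : X → C} (hj : IsUniformInducing j)
    (hd : DenseRange j) (g : (ι → X) → Z) (hg : UniformContinuous g) :
    ∃ G : (ι → C) → Z, UniformContinuous G ∧ ∀ a, G (j ∘ a) = g a := by
  have hJ : IsUniformInducing (Pi.map (fun _ : ι => j)) := isUniformInducing_piMap hj
  have hD : DenseRange (Pi.map (fun _ : ι => j)) := .piMap fun _ => hd
  exact ⟨_, uniformContinuous_uniformly_extend hJ hD hg,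
    fun a => uniformly_extend_of_ind hJ hD hg a⟩

end UniformExtension

namespace PreStructure

variable {L : Signature} {M : Type u} {A : Type v}

/-! ### The metric completion -/

section Completion

variable (S : PreStructure L M)

instance : CompleteSpace S.Completion :=
  letI := S.pseudoMetricSpace
  (inferInstance : CompleteSpace (UniformSpace.Completion (SeparationQuotient M)))

theorem dist_toCompletion (x y : M) :
    dist (S.toCompletion x) (S.toCompletion y) = S.sim x y := by
  let := S.pseudoMetricSpace
  exact (UniformSpace.Completion.dist_eq _ _).trans (SeparationQuotient.dist_mk x y)

theorem denseRange_toCompletion : DenseRange S.toCompletion := by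
  let := S.pseudoMetricSpace
  exact UniformSpace.Completion.denseRange_coe.comp SeparationQuotient.surjective_mk.denseRange
    (UniformSpace.Completion.continuous_coe _)

/-- Makes the distance a truth value, so that it can interpret `≈`. The condition is closed and
holds on the dense image. -/
theorem dist_completion_le_one (x y : S.Completion) : dist x y ≤ 1 := by
  refine S.denseRange_toCompletion.induction_on₂ (p := fun x y => dist x y ≤ 1)
    (isClosed_le continuous_dist continuous_const) (fun a b => ?_) x y
  rw [dist_toCompletion]
  exact (S.sim a b).2.2

theorem isUniformInducing_toCompletion :
    @IsUniformInducing _ _ S.pseudoMetricSpace.toUniformSpace _ S.toCompletion := by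
  let := S.pseudoMetricSpace
  exact (Isometry.of_dist_eq S.dist_toCompletion).isUniformInducing

end Completion

/-! ### Truth values of the derived connectives -/

section TruthValues

theorem coe_tsub (y x : unitInterval) : (tsub y x : ℝ) = max ((y : ℝ) - x) 0 := rfl

theorem val_or (S : PreStructure L M) (ρ : A → M) (e : ℕ → M) (φ ψ : Formula L A) :
    S.val ρ e (φ.or ψ) = min (S.val ρ e φ) (S.val ρ e ψ) := by
  apply Subtype.ext
  have hφ := (S.val ρ e φ).2.1
  have hψ := (S.val ρ e ψ).2.1
  have hmin : ((min (S.val ρ e φ) (S.val ρ e ψ) : unitInterval) : ℝ) =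
      min (S.val ρ e φ : ℝ) (S.val ρ e ψ) := (Subtype.mono_coe _).map_min
  rw [hmin]
  simp only [Formula.or, val, coe_tsub]
  rcases le_total (S.val ρ e φ : ℝ) (S.val ρ e ψ) with h | h
  · rw [min_eq_left h, max_eq_left (sub_nonneg.2 h), sub_sub_cancel, max_eq_left hφ]
  · rw [min_eq_right h, max_eq_right (sub_nonpos.2 h), sub_zero, max_eq_left hψ]

theorem val_minus (S : PreStructure L M) (ρ : A → M) (e : ℕ → M) (φ ψ : Formula L A) :
    S.val ρ e (φ.minus ψ) = tsub (S.val ρ e φ) (S.val ρ e ψ) := rfl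

theorem tsub_eq_zero_iff {y x : unitInterval} : tsub y x = 0 ↔ y ≤ x := by
  rw [← Subtype.coe_le_coe, ← sub_nonpos, ← max_eq_right_iff, ← coe_tsub, Subtype.ext_iff]
  rfl

/-- The meaning of a uniform continuity axiom. -/
theorem le_or_of_val_or_eq_zero (S : PreStructure L M) (ρ : A → M) (e : ℕ → M) (φ ψ : Formula L A)
    (q r : RatUnit)
    (h : S.val ρ e (Formula.or ((Formula.const q).minus φ) (ψ.minus (Formula.const r))) = 0) :
    (q.1 : ℝ) ≤ S.val ρ e φ ∨ (S.val ρ e ψ : ℝ) ≤ r.1 := by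
  rw [val_or, val_minus, val_minus] at h
  -- Truth values are linearly ordered, so a minimum equal to `0` is a disjunct equal to `0`.
  rcases min_choice (tsub (S.val ρ e (.const q)) (S.val ρ e φ))
    (tsub (S.val ρ e ψ) (S.val ρ e (.const r))) with h' | h'
  · exact .inl (tsub_eq_zero_iff.1 (h'.symm.trans h))
  · exact .inr (tsub_eq_zero_iff.1 (h'.symm.trans h))

end TruthValues

/-! ### From the axioms `UL` to uniform continuity -/

section UniformContinuity

/-- Every positive real has rationals `0 < ε < r` of the unit interval below it. -/
theorem exists_ratUnit_between {η : ℝ} (hη : 0 < η) :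
    ∃ ε r : RatUnit, (ε.1 : ℝ) ∈ Set.Ioc (0 : ℝ) 1 ∧ ε < r ∧ (r.1 : ℝ) ≤ η := by
  obtain ⟨r, hr₀, hr⟩ := exists_rat_btwn (lt_min hη one_pos)
  have hr1 : (r : ℝ) ≤ 1 := hr.le.trans (min_le_right _ _)
  have hr0' : (0 : ℚ) < r := by exact_mod_cast hr₀
  have hr1' : r ≤ 1 := by exact_mod_cast hr1
  refine ⟨⟨r / 2, by linarith, by linarith⟩, ⟨r, hr0'.le, hr1'⟩, ⟨?_, ?_⟩, ?_,
    hr.le.trans (min_le_left _ _)⟩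
  · push_cast; linarith
  · push_cast; linarith
  · exact Subtype.mk_lt_mk.2 (by linarith)

/-- Any real smaller than some `δ ≤ 1` is below a rational of the unit interval smaller than `δ`. -/
theorem exists_ratUnit_lt {d δ : ℝ} (hd : 0 ≤ d) (hδ : δ ≤ 1) (h : d < δ) :
    ∃ q : RatUnit, d < q.1 ∧ (q.1 : ℝ) < δ := by
  obtain ⟨q, hq₁, hq₂⟩ := exists_rat_btwn h
  exact ⟨⟨q, by exact_mod_cast hd.trans hq₁.le, by exact_mod_cast hq₂.le.trans hδ⟩, hq₁, hq₂⟩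

/-- An evaluation of the variables `0, …, n - 1` by `a` and of the other variables by `y`. -/
def tupleEval {n : ℕ} (a : Fin n → M) (y : M) (k : ℕ) : M := if h : k < n then a ⟨k, h⟩ else y

@[simp] theorem tupleEval_coe {n : ℕ} (a : Fin n → M) (y : M) (i : Fin n) :
    tupleEval a y i = a i := by simp [tupleEval]

@[simp] theorem tupleEval_self {n : ℕ} (a : Fin n → M) (y : M) : tupleEval a y n = y := by
  simp [tupleEval]

theorem termVal_update_var (S : PreStructure L M) (ρ : A → M) {n : ℕ} (a : Fin n → M) (y : M)
    (i : Fin n) :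
    (fun j => S.termVal ρ (tupleEval a y)
      (Function.update (fun k : Fin n => (Term.var k : Term L A)) i (.var n) j)) =
      Function.update a i y := by
  funext j
  by_cases h : j = i
  · subst h; simp [termVal]
  · simp [h, termVal]

variable {S : PreStructure L M}

/-- The modulus at a rational `ε` below `η` serves as `δ`. The one-sided bound becomes two-sided by
exchanging the two points. -/
theorem rel_sub_le_of_models (hS : S.Models {φ | UL L φ}) (R : L.Rel)
    (i : Fin (L.relArity R)) {η : ℝ} (hη : 0 < η) :
    ∃ δ > 0, ∀ (a : Fin (L.relArity R) → M) (y : M), (S.sim (a i) y : ℝ) < δ →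
      (S.rel R a : ℝ) - S.rel R (Function.update a i y) ≤ η := by
  obtain ⟨ε, r, hε, hεr, hr⟩ := exists_ratUnit_between hη
  refine ⟨L.relMod R i ⟨_, hε⟩, (L.relMod R i ⟨_, hε⟩).2.1, fun a y hay => ?_⟩
  -- `q` may depend on `a` and `y`, since `δ` does not depend on `q`. As `q` exceeds the distance,
  -- the first disjunct of the axiom fails.
  obtain ⟨q, hq₁, hq₂⟩ := exists_ratUnit_lt (S.sim (a i) y).2.1 (L.relMod R i ⟨_, hε⟩).2.2 hay
  have := S.le_or_of_val_or_eq_zero _ _ _ _ q r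
    (hS _ (UL.rel R i ε q r hε hεr hq₂) (tupleEval a y))
  rw [val_minus] at this
  simp only [val, termVal_update_var, coe_tsub] at this
  simp only [termVal, tupleEval_coe, tupleEval_self] at this
  rcases this with h | h
  · exact absurd h hq₁.not_ge
  · exact (le_max_left _ _).trans (h.trans hr)

theorem sim_fn_le_of_models (hS : S.Models {φ | UL L φ}) (f : L.Fn)
    (i : Fin (L.fnArity f)) {η : ℝ} (hη : 0 < η) :
    ∃ δ > 0, ∀ (a : Fin (L.fnArity f) → M) (y : M), (S.sim (a i) y : ℝ) < δ →
      (S.sim (S.fn f a) (S.fn f (Function.update a i y)) : ℝ) ≤ η := by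
  obtain ⟨ε, r, hε, hεr, hr⟩ := exists_ratUnit_between hη
  refine ⟨L.fnMod f i ⟨_, hε⟩, (L.fnMod f i ⟨_, hε⟩).2.1, fun a y hay => ?_⟩
  obtain ⟨q, hq₁, hq₂⟩ := exists_ratUnit_lt (S.sim (a i) y).2.1 (L.fnMod f i ⟨_, hε⟩).2.2 hay
  have := S.le_or_of_val_or_eq_zero _ _ _ _ q r
    (hS _ (UL.fn f i ε q r hε hεr hq₂) (tupleEval a y))
  simp only [val, termVal, termVal_update_var] at this
  simp only [tupleEval_coe, tupleEval_self] at this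
  rcases this with h | h
  · exact absurd h hq₁.not_ge
  · exact h.trans hr

theorem uniformContinuous_rel_of_models (hS : S.Models {φ | UL L φ}) (R : L.Rel) :
    letI := S.pseudoMetricSpace
    UniformContinuous (S.rel R) := by
  let := S.pseudoMetricSpace
  refine uniformContinuous_of_forall_update _ fun i ε hε => ?_
  obtain ⟨δ, hδ, h⟩ := rel_sub_le_of_models hS R i hε
  refine ⟨δ, hδ, fun a y hay => ?_⟩
  rw [Subtype.dist_eq, Real.dist_eq, abs_sub_le_iff]
  refine ⟨h a y hay, ?_⟩
  -- Start from the changed tuple and restore its `i`-th entry.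
  have := h (Function.update a i y) (a i) (by
    rw [Function.update_self, S.sim_comm]; exact hay)
  simpa using this

theorem uniformContinuous_fn_of_models (hS : S.Models {φ | UL L φ}) (f : L.Fn) :
    letI := S.pseudoMetricSpace
    UniformContinuous (S.fn f) := by
  let := S.pseudoMetricSpace
  refine uniformContinuous_of_forall_update _ fun i ε hε => ?_
  exact sim_fn_le_of_models hS f i hε

end UniformContinuity

/-! ### The structure on the completion -/

section CompletionStructure

/-- A model of the uniform continuity axioms extends to a structure on its metric completion with
uniformly continuous functions and relations. -/
theorem exists_completion_structure {S : PreStructure L M} (hS : S.Models {φ | UL L φ}) :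
    ∃ N : PreStructure L S.Completion, (∀ x y, (N.sim x y : ℝ) = dist x y) ∧
      (∀ f, UniformContinuous (N.fn f)) ∧ (∀ R, UniformContinuous (N.rel R)) ∧
      (∀ f a, N.fn f (S.toCompletion ∘ a) = S.toCompletion (S.fn f a)) ∧
      ∀ R a, N.rel R (S.toCompletion ∘ a) = S.rel R a := by
  let := S.pseudoMetricSpace
  have hj := S.isUniformInducing_toCompletion
  have hd := S.denseRange_toCompletion
  -- The extension theorem needs a complete separated target, so the functions are first composed
  -- with the map into the completion.
  choose F hFc hF using fun f => exists_uniformContinuous_extension hj hd _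
    (hj.uniformContinuous.comp (uniformContinuous_fn_of_models hS f))
  choose G hGc hG using fun R => exists_uniformContinuous_extension hj hd _
    (uniformContinuous_rel_of_models hS R)
  exact ⟨{  fn := F
            rel := G
            sim := fun x y => ⟨dist x y, dist_nonneg, S.dist_completion_le_one x y⟩
            sim_self := fun x => Subtype.ext (dist_self x)
            sim_comm := fun x y => Subtype.ext (dist_comm x y)
            sim_triangle := dist_triangle }, fun _ _ => rfl, hFc, hGc, hF, hG⟩

end CompletionStructure

/-! ### Continuity of terms and formulas in the evaluation -/

section Metric

variable {N : Type w} [MetricSpace N] {S' : PreStructure L N}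

/-- Completeness and density of a structure refer to the pseudo-metric built from `sim`; this
identifies it with the given metric. -/
theorem pseudoMetricSpace_eq (hsim : ∀ x y, (S'.sim x y : ℝ) = dist x y) :
    S'.pseudoMetricSpace = ‹MetricSpace N›.toPseudoMetricSpace := by
  apply PseudoMetricSpace.ext
  ext x y
  exact hsim x y

theorem isMetric_of_sim_eq_dist (hsim : ∀ x y, (S'.sim x y : ℝ) = dist x y) : S'.IsMetric := by
  intro x y h
  rw [← dist_eq_zero, ← hsim, h]
  rfl

theorem isComplete_of_sim_eq_dist [CompleteSpace N] (hsim : ∀ x y, (S'.sim x y : ℝ) = dist x y) :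
    S'.IsComplete := by
  rw [IsComplete, pseudoMetricSpace_eq hsim]
  infer_instance

theorem exists_dist_termVal_le (hf : ∀ f, UniformContinuous (S'.fn f)) (ρ : A → N)
    (t : Term L A) {ε : ℝ} (hε : 0 < ε) :
    ∃ δ > 0, ∀ e e' : ℕ → N, (∀ n, dist (e n) (e' n) < δ) →
      dist (S'.termVal ρ e t) (S'.termVal ρ e' t) < ε := by
  induction t generalizing ε with
  | var n => exact ⟨ε, hε, fun e e' h => h n⟩
  | param a => exact ⟨1, one_pos, fun e e' _ => by simpa [termVal] using hε⟩
  | app f ts ih =>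
    obtain ⟨δ, hδ, h⟩ := Metric.uniformContinuous_iff.1 (hf f) ε hε
    choose η hη hη' using fun i => ih i hδ
    obtain ⟨θ, hθ, hθη⟩ := exists_pos_forall_lt_of_finite hη
    refine ⟨θ, hθ, fun e e' hee => h ((dist_pi_lt_iff hδ).2 fun i => ?_)⟩
    exact hη' i e e' fun n => (hee n).trans (hθη i)

/-- The truth degree of a formula depends uniformly continuously on the evaluation, with respect to
uniform distance. -/
theorem exists_dist_val_le (hsim : ∀ x y, (S'.sim x y : ℝ) = dist x y)
    (hf : ∀ f, UniformContinuous (S'.fn f)) (hR : ∀ R, UniformContinuous (S'.rel R)) (ρ : A → N)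
    (φ : Formula L A) {ε : ℝ} (hε : 0 < ε) :
    ∃ δ > 0, ∀ e e' : ℕ → N, (∀ n, dist (e n) (e' n) < δ) →
      (S'.val ρ e φ : ℝ) ≤ S'.val ρ e' φ + ε := by
  induction φ generalizing ε with
  | rel R ts =>
    obtain ⟨δ, hδ, h⟩ := Metric.uniformContinuous_iff.1 (hR R) ε hε
    choose η hη hη' using fun i => exists_dist_termVal_le hf ρ (ts i) hδ
    obtain ⟨θ, hθ, hθη⟩ := exists_pos_forall_lt_of_finite hη
    refine ⟨θ, hθ, fun e e' hee => ?_⟩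
    have := h ((dist_pi_lt_iff hδ).2 fun i => hη' i e e' fun n => (hee n).trans (hθη i))
    rw [Subtype.dist_eq, Real.dist_eq] at this
    simp only [val]
    linarith [le_abs_self ((S'.rel R fun i => S'.termVal ρ e (ts i) : ℝ) -
      S'.rel R fun i => S'.termVal ρ e' (ts i))]
  | sim t s =>
    obtain ⟨δ₁, hδ₁, h₁⟩ := exists_dist_termVal_le hf ρ t (half_pos hε)
    obtain ⟨δ₂, hδ₂, h₂⟩ := exists_dist_termVal_le hf ρ s (half_pos hε)
    refine ⟨min δ₁ δ₂, lt_min hδ₁ hδ₂, fun e e' hee => ?_⟩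
    have e₁ := h₁ e e' fun n => (hee n).trans_le (min_le_left _ _)
    have e₂ := h₂ e e' fun n => (hee n).trans_le (min_le_right _ _)
    rw [dist_comm (S'.termVal ρ e s)] at e₂
    simp only [val, hsim]
    linarith [dist_triangle4 (S'.termVal ρ e t) (S'.termVal ρ e' t) (S'.termVal ρ e' s)
      (S'.termVal ρ e s)]
  | const r => exact ⟨1, one_pos, fun e e' _ => by simp only [val]; linarith⟩
  | imp φ ψ ihφ ihψ =>
    obtain ⟨δ₁, hδ₁, h₁⟩ := ihφ (half_pos hε)
    obtain ⟨δ₂, hδ₂, h₂⟩ := ihψ (half_pos hε)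
    refine ⟨min δ₁ δ₂, lt_min hδ₁ hδ₂, fun e e' hee => ?_⟩
    -- The implication is antitone in its antecedent, so the evaluations are exchanged here.
    have e₁ := h₁ e' e fun n => (dist_comm (e' n) _).trans_lt ((hee n).trans_le (min_le_left _ _))
    have e₂ := h₂ e e' fun n => (hee n).trans_le (min_le_right _ _)
    simp only [val, coe_tsub]
    refine max_le ?_ (by positivity)
    linarith [le_max_left ((S'.val ρ e' ψ : ℝ) - S'.val ρ e' φ) 0]
  | all x φ ih =>
    obtain ⟨δ, hδ, h⟩ := ih hε
    refine ⟨δ, hδ, fun e e' hee => ?_⟩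
    -- Giving `x` the same value in both evaluations keeps them `δ`-close, so the `δ` of `φ` works
    -- for every instance.
    have hle : ∀ a, (S'.val ρ (Function.update e x a) φ : ℝ) ≤ S'.val ρ e' (.all x φ) + ε := by
      intro a
      refine (h _ (Function.update e' x a) fun n => ?_).trans ?_
      · by_cases hn : n = x
        · subst hn; simpa using hδ
        · simpa [hn] using hee n
      · gcongr
        exact le_iSup (fun a => S'.val ρ (Function.update e' x a) φ) a
    -- The supremum is taken in `unitInterval`, so the bound must lie there; otherwise it exceeds
    -- `1` and the claim is trivial.
    by_cases h1 : (S'.val ρ e' (.all x φ) : ℝ) + ε ≤ 1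
    · have : S'.val ρ e (.all x φ) ≤
          ⟨S'.val ρ e' (.all x φ) + ε, add_nonneg (S'.val ρ e' (.all x φ)).2.1 hε.le, h1⟩ :=
        iSup_le hle
      exact this
    · exact (S'.val ρ e (.all x φ)).2.2.trans (not_le.1 h1).le

end Metric

theorem elemDiagram_comp {N : Type w} {S : PreStructure L M} {S' : PreStructure L N} {j : M → N}
    {ρ : A → M} (h : ∀ φ, S'.degree (j ∘ ρ) φ = S.degree ρ φ) :
    S'.elemDiagram (j ∘ ρ) = S.elemDiagram ρ := by
  simp only [elemDiagram, h]

theorem termVal_comp {N : Type w} {S : PreStructure L M} {S' : PreStructure L N} {j : M → N}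
    (hjf : ∀ f a, S'.fn f (j ∘ a) = j (S.fn f a)) (ρ : A → M) (e : ℕ → M) (t : Term L A) : S'.termVal (j ∘ ρ) (j ∘ e) t = j (S.termVal ρ e t) := by
  induction t with
  | var n => rfl
  | param a => rfl
  | app f ts ih =>
    simp only [termVal, ih]
    exact hjf f fun i => S.termVal ρ e (ts i)

/-! ### Truth degrees on a dense substructure -/

section DenseSubstructure

variable {N : Type w} [MetricSpace N] {S : PreStructure L M} {S' : PreStructure L N} {j : M → N}

/-- A bound on the truth degrees under arbitrarily close evaluations is a bound on the truth
degree. -/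
theorem val_le_of_forall_exists_dist_lt (hsim : ∀ x y, (S'.sim x y : ℝ) = dist x y)
    (hf : ∀ f, UniformContinuous (S'.fn f)) (hR : ∀ R, UniformContinuous (S'.rel R)) (ρ : A → N)
    (φ : Formula L A) {c : unitInterval} (e : ℕ → N)
    (h : ∀ δ > 0, ∃ e' : ℕ → N, (∀ n, dist (e n) (e' n) < δ) ∧ S'.val ρ e' φ ≤ c) :
    S'.val ρ e φ ≤ c := by
  refine Subtype.coe_le_coe.1 (le_of_forall_pos_le_add fun ε hε => ?_)
  obtain ⟨δ, hδ, hv⟩ := exists_dist_val_le hsim hf hR ρ φ hε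
  obtain ⟨e', he', hc⟩ := h δ hδ
  have hc' : (S'.val ρ e' φ : ℝ) ≤ c := hc
  linarith [hv e e' he']

/-- Truth degrees are preserved by maps onto dense substructures. -/
theorem val_comp (hj : DenseRange j) (hsim : ∀ x y, (S'.sim x y : ℝ) = dist x y)
    (hf : ∀ f, UniformContinuous (S'.fn f)) (hR : ∀ R, UniformContinuous (S'.rel R))
    (hjf : ∀ f a, S'.fn f (j ∘ a) = j (S.fn f a)) (hjR : ∀ R a, S'.rel R (j ∘ a) = S.rel R a)
    (hjs : ∀ x y, S'.sim (j x) (j y) = S.sim x y) (ρ : A → M) (e : ℕ → M) (φ : Formula L A) :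
    S'.val (j ∘ ρ) (j ∘ e) φ = S.val ρ e φ := by
  induction φ generalizing e with
  | rel R ts =>
    simp only [val, termVal_comp hjf]
    exact hjR R fun i => S.termVal ρ e (ts i)
  | sim t s => simp only [val, termVal_comp hjf, hjs]
  | const r => rfl
  | imp φ ψ ihφ ihψ => simp only [val, ihφ, ihψ]
  | all x φ ih =>
    have hval : ∀ m, S'.val (j ∘ ρ) (Function.update (j ∘ e) x (j m)) φ =
        S.val ρ (Function.update e x m) φ := fun m => by
      rw [← ih, Function.comp_update]
    refine le_antisymm (iSup_le fun a => ?_) (iSup_le fun m => ?_)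
    -- An instance at an arbitrary `a` is approximated by instances at points `j m`, which the
    -- induction hypothesis covers.
    · refine val_le_of_forall_exists_dist_lt hsim hf hR _ φ _ fun δ hδ => ?_
      obtain ⟨m, hm⟩ := hj.exists_dist_lt a hδ
      refine ⟨Function.update (j ∘ e) x (j m), fun n => ?_, ?_⟩
      · by_cases hn : n = x
        · subst hn; simpa using hm
        · simpa [hn] using hδ
      · rw [hval]
        exact le_iSup (fun m => S.val ρ (Function.update e x m) φ) m
    · rw [← hval]
      exact le_iSup (fun a => S'.val (j ∘ ρ) (Function.update (j ∘ e) x a) φ) (j m)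

theorem degree_comp (hj : DenseRange j) (hsim : ∀ x y, (S'.sim x y : ℝ) = dist x y)
    (hf : ∀ f, UniformContinuous (S'.fn f)) (hR : ∀ R, UniformContinuous (S'.rel R))
    (hjv : ∀ (ρ : A → M) e φ, S'.val (j ∘ ρ) (j ∘ e) φ = S.val ρ e φ) (ρ : A → M)
    (φ : Formula L A) : S'.degree (j ∘ ρ) φ = S.degree ρ φ := by
  refine le_antisymm (iSup_le fun e => ?_) (iSup_le fun e => ?_)
  · refine val_le_of_forall_exists_dist_lt hsim hf hR _ φ _ fun δ hδ => ?_
    -- All infinitely many variables are moved at once, within the same `δ`; continuity for the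
    -- uniform distance permits this.
    choose e' he' using fun n => hj.exists_dist_lt (e n) hδ
    refine ⟨j ∘ e', he', ?_⟩
    rw [hjv]
    exact le_iSup (fun e => S.val ρ e φ) e'
  · rw [← hjv]
    exact le_iSup (fun e => S'.val (j ∘ ρ) e φ) (j ∘ e)

end DenseSubstructure

end PreStructure

end RPL

/-! ### The completion theorem -/

theorem theorem3p12 {L : RPL.Signature} (hL : L.ComputablyGiven)
    (T : Set (RPL.LFormula L))
    (hcons : RPL.Consistent (RPL.withUL T))
    (hlin : RPL.LinearComplete (RPL.withUL T))
    (hax : RPL.ComputablyAxiomatizable (RPL.withUL T))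
    (hhenkin : RPL.Henkin (RPL.withUL T))
    {M : Type*} (S : RPL.PreStructure L M) (hS : S.Models (RPL.withUL T))
    (ν : ℕ → M) (hν : Function.Surjective ν) (hdec : S.DecidableOver ν) :
    ∃ N : RPL.PreStructure L S.Completion,
      (∀ x y, (N.sim x y : ℝ) = dist x y) ∧
      N.IsMetric ∧ N.IsComplete ∧
      N.Models (RPL.withUL T) ∧
      S.IsElementaryMap N S.toCompletion ∧
      S.ElementarilyEquivalent N ∧
      N.elemDiagram S.toCompletion = S.elemDiagram id ∧
      N.DecidableOver (S.toCompletion ∘ ν) ∧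
      N.IsDecidable := by
  obtain ⟨N, hsim, hf, hR, hjf, hjR⟩ :=
    RPL.PreStructure.exists_completion_structure (S := S) fun φ hφ => hS φ (.inr hφ)
  have hd := S.denseRange_toCompletion
  have hjs : ∀ x y, N.sim (S.toCompletion x) (S.toCompletion y) = S.sim x y := fun x y =>
    Subtype.ext ((hsim _ _).trans (S.dist_toCompletion x y))
  have hval := fun (A : Type _) => RPL.PreStructure.val_comp (A := A) hd hsim hf hR hjf hjR hjs
  have hval₀ := RPL.PreStructure.val_comp (A := Empty) hd hsim hf hR hjf hjR hjs
  have hvalNat := RPL.PreStructure.val_comp (A := ℕ) hd hsim hf hR hjf hjR hjs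
  have hempty : S.toCompletion ∘ (Empty.elim : Empty → M) = Empty.elim := Subsingleton.elim _ _
  have hdeg₀ : ∀ φ : RPL.LFormula L, N.degree Empty.elim φ = S.degree Empty.elim φ := fun φ => by
    rw [← hempty]
    exact RPL.PreStructure.degree_comp hd hsim hf hR hval₀ _ φ
  have hdec' : N.DecidableOver (S.toCompletion ∘ ν) := by
    refine ⟨?_, ?_⟩
    -- As `ν` is onto, the sequence has the same range as the canonical map.
    · rw [RPL.PreStructure.pseudoMetricSpace_eq hsim, DenseRange, hν.range_comp]
      exact hd
    · rw [RPL.PreStructure.elemDiagram_comp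
        (RPL.PreStructure.degree_comp hd hsim hf hR hvalNat ν)]
      exact hdec.2
  refine ⟨N, hsim, RPL.PreStructure.isMetric_of_sim_eq_dist hsim,
    RPL.PreStructure.isComplete_of_sim_eq_dist hsim, fun φ hφ e => ?_,
    ⟨fun f a => (hjf f a).symm, fun φ e => hval M id e φ⟩, fun φ _ => (hdeg₀ φ).symm,
    RPL.PreStructure.elemDiagram_comp (ρ := id)
      (RPL.PreStructure.degree_comp hd hsim hf hR (hval M) id), hdec', _, hdec'⟩
  -- Axioms may have free variables, and an evaluation in the completion need not come from B. The
  -- degree bounds the values under all evaluations at once.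
  have hzero : S.degree Empty.elim φ ≤ 0 := iSup_le fun e => (hS φ hφ e).le
  rw [← hdeg₀] at hzero
  exact le_antisymm ((le_iSup (fun e => N.val Empty.elim e φ) e).trans hzero) bot_le
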